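/- Adaptive 1-bit compressive sensing. Let $1 \le K \le N$ and $T \ge 0$ be integers. Let $\beta$ be a random vector in $\mathbb{R}^N$ whose support $S = \{k : \beta_k \ne 0\}$ is uniformly distributed among the $\binom{N}{K}$ subsets of $\{1,\dots,N\}$ of size $K$ (the values of the nonzero coefficients are otherwise arbitrary). Let $W^{(1)},\dots,W^{(T)}$ be IID real random variables with an arbitrary law (possibly $0$), independent of $\beta$. Measurements are made sequentially: $$Y^{(t)} = Q\big(\langle X^{(t)}, \beta\rangle + W^{(t)}\big), \qquad t = 1,\dots,T,$$ where $Q(x) = 1$ if $x \ge 0$ and $Q(x) = 0$ otherwise, and where $X^{(t)} \in \mathbb{R}^N$ is chosen adaptively as a (possibly random) measurable function of $X^{(1)},\dots,X^{(t-1)}$ and $Y^{(1)},\dots,Y^{(t-1)}$; the internal randomness of the sensing strategy, which may be shared between different $t$, is independent of $(\beta, W^{(1)},\dots,W^{(T)})$. A decoder $g$ produces an estimate $\hat S = g(X^{(1)},\dots,X^{(T)},Y^{(1)},\dots,Y^{(T)})$ of $S$, with error probability $P_e = \Pr(\hat S \ne S)$. Then $\Omega(K\log(N/K))$ measurements are necessary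 for a small error probability: 1. There are absolute constants $c > 0$ and $\varepsilon_0 > 0$ such that, for all $N, K, T$, all laws of $\beta$ and of the noise as above, all adaptive strategies and all decoders, $P_e \le \varepsilon_0$ implies $T \ge c\, K \log(N/K)$. 2. In particular, for every sequence of such problems, with parameters $(N_n, K_n, T_n)$, adaptive strategies and decoders, whose error probability tends to $0$ as $n \to \infty$, one has $T_n = \Omega(K_n \log(N_n/K_n))$. -/

import Mathlib

open MeasureTheory ProbabilityTheory Filter Topology Asymptotics

/-- The 1-bit quantizer: output `1` if the input is nonnegative and `0` otherwise. -/
noncomputable def quantizer (x : ℝ) : Fin 2 := if 0 ≤ x then 1 else 0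

/-- The support of a vector in `ℝ^N`, as a finite set of indices. -/
noncomputable def vectorSupport {N : ℕ} (b : Fin N → ℝ) : Finset (Fin N) :=
  Finset.univ.filter (fun k => b k ≠ 0)

/-- Adaptive 1-bit compressive sensing with `T` measurements of a random `K`-sparse vector of
length `N`, on the probability space `(Ω, μ)`; the internal randomness of the sensing strategy
takes values in `𝓤`. -/
structure AdaptiveOneBitCS (N K T : ℕ) {Ω 𝓤 : Type*} [MeasurableSpace Ω] [MeasurableSpace 𝓤]
    (μ : Measure Ω) where
  /-- the unknown random vector -/
  β : Ω → Fin N → ℝ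
  measurable_β : Measurable β
  /-- the support of `β` is uniformly distributed among the sets of size `K`; the values of the
  nonzero coefficients are arbitrary -/
  uniform_support : ∀ S : Finset (Fin N), S.card = K →
    μ.real {ω | vectorSupport (β ω) = S} = 1 / (N.choose K : ℝ)
  /-- the noise, IID across measurements and independent of `β` -/
  W : Fin T → Ω → ℝ
  measurable_W : ∀ t, Measurable (W t)
  indep_W : iIndepFun W μ
  ident_W : ∀ s t, IdentDistrib (W s) (W t) μ μ
  indep_β_W : IndepFun β (fun ω t => W t ω) μ
  /-- the internal randomness of the sensing strategy, independent of the vector and the noise -/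
  U : Ω → 𝓤
  measurable_U : Measurable U
  indep_U : IndepFun U (fun ω => (β ω, fun t => W t ω)) μ
  /-- the adaptive rule: the `t`-th row of the sensing matrix is a (random) function of the
  previous rows and the previous outputs -/
  f : (t : Fin T) → (Set.Iio t → Fin N → ℝ) → (Set.Iio t → Fin 2) → 𝓤 → Fin N → ℝ
  measurable_f : ∀ t, Measurable
    (fun p : (Set.Iio t → Fin N → ℝ) × (Set.Iio t → Fin 2) × 𝓤 => f t p.1 p.2.1 p.2.2)
  /-- the rows of the sensing matrix -/
  X : Fin T → Ω → Fin N → ℝ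
  /-- the measurement outputs -/
  Y : Fin T → Ω → Fin 2
  X_eq : ∀ t ω, X t ω = f t (fun s => X s ω) (fun s => Y s ω) (U ω)
  Y_eq : ∀ t ω, Y t ω = quantizer (X t ω ⬝ᵥ β ω + W t ω)
  /-- the decoder, which estimates the support from the sensing matrix and the outputs -/
  g : (Fin T → Fin N → ℝ) → (Fin T → Fin 2) → Finset (Fin N)
  measurable_g : ∀ S : Finset (Fin N),
    MeasurableSet {p : (Fin T → Fin N → ℝ) × (Fin T → Fin 2) | g p.1 p.2 = S}

/-- The probability that the decoder's estimate differs from the support of `β`. -/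
noncomputable def AdaptiveOneBitCS.errorProb {N K T : ℕ} {Ω 𝓤 : Type*} [MeasurableSpace Ω]
    [MeasurableSpace 𝓤] {μ : Measure Ω} (M : AdaptiveOneBitCS N K T (𝓤 := 𝓤) μ) : ℝ :=
  μ.real {ω | M.g (fun t => M.X t ω) (fun t => M.Y t ω) ≠ vectorSupport (M.β ω)}

/-!
Conditionally on the internal randomness `U = u`, the rows of the sensing matrix are determined by
the outputs, however adaptive the strategy is. So the decoder's estimate is one of at most `2 ^ T`
sets `M.estimate u y`, indexed by the possible output words `y`
(`AdaptiveOneBitCS.estimate_eq_decoder`). The support of `β` is uniform on the `N.choose K` sets of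
size `K` and independent of `U`, so each of these sets is the support with probability at most
`1 / N.choose K` (`AdaptiveOneBitCS.measureReal_estimate_eq_support_le`), and a union bound gives
`1 - P_e ≤ 2 ^ T / N.choose K` (`AdaptiveOneBitCS.one_sub_errorProb_le`). With `P_e ≤ 1 / 4`, this
yields `N.choose K ≤ 4 ^ T`, while `(N / K) ^ K ≤ N.choose K`; take logarithms. The law of the
noise plays no role, since the bound only counts output words.
-/

/-- The binomial coefficient `n.choose k` dominates `(n / k) ^ k`, because
`n.choose k = (n / k) * (n - 1).choose (k - 1)` and, for `1 < k ≤ n`,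
`n / k ≤ (n - 1) / (k - 1)`. -/
theorem div_pow_le_choose {k n : ℕ} (hkn : k ≤ n) :
    ((n : ℝ) / k) ^ k ≤ (n.choose k : ℝ) := by
  induction k generalizing n with
  | zero => simp
  | succ k ih =>
    obtain ⟨m, rfl⟩ : ∃ m, n = m + 1 := ⟨n - 1, by omega⟩
    have hkm : k ≤ m := by omega
    have hrec : ((m + 1).choose (k + 1) : ℝ) = ((m + 1 : ℕ) : ℝ) / (k + 1 : ℕ) * m.choose k := by
      have h := Nat.add_one_mul_choose_eq m k
      have h' : ((m : ℝ) + 1) * m.choose k = (m + 1).choose (k + 1) * ((k : ℝ) + 1) := by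
        exact_mod_cast h
      push_cast
      field_simp
      linarith
    have hmono : (((m + 1 : ℕ) : ℝ) / (k + 1 : ℕ)) ^ k ≤ ((m : ℝ) / k) ^ k := by
      rcases Nat.eq_zero_or_pos k with rfl | hk
      · simp
      · have hk' : (0 : ℝ) < k := by exact_mod_cast hk
        have hkm' : (k : ℝ) ≤ m := by exact_mod_cast hkm
        gcongr ?_ ^ k
        push_cast
        rw [div_le_div_iff₀ (by positivity) hk']
        nlinarith
    rw [hrec, pow_succ']
    gcongr
    exact hmono.trans (ih hkm)

theorem measurableSet_vectorSupport_eq {N : ℕ} (S : Finset (Fin N)) :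
    MeasurableSet {b : Fin N → ℝ | vectorSupport b = S} := by
  have h : {b : Fin N → ℝ | vectorSupport b = S}
      = ⋂ k, {b : Fin N → ℝ | b k ≠ 0 ↔ k ∈ S} := by
    ext b
    simp [vectorSupport, Finset.ext_iff]
  rw [h]
  refine MeasurableSet.iInter fun k => ?_
  have hk : MeasurableSet {b : Fin N → ℝ | b k = 0} :=
    (measurableSet_singleton (0 : ℝ)).preimage (measurable_pi_apply k)
  by_cases hS : k ∈ S
  · simp only [hS, iff_true]
    exact hk.compl
  · simpa only [hS, iff_false, not_not] using hk

namespace AdaptiveOneBitCS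

variable {N K T : ℕ} {Ω 𝓤 : Type*} [MeasurableSpace Ω] [MeasurableSpace 𝓤] {μ : Measure Ω}

/-- The rows of the sensing matrix which the strategy produces when its internal randomness is `u`
and the outputs are prescribed to be the word `y`. -/
noncomputable def rows (M : AdaptiveOneBitCS N K T (𝓤 := 𝓤) μ) (u : 𝓤) (y : Fin T → Fin 2)
    (t : Fin T) : Fin N → ℝ :=
  M.f t (fun s => rows M u y s.1) (fun s => y s.1) u
termination_by t.val
decreasing_by exact s.2

/-- The decoder's estimate when the internal randomness is `u` and the outputs are prescribed to
be the word `y`. -/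
noncomputable def estimate (M : AdaptiveOneBitCS N K T (𝓤 := 𝓤) μ) (u : 𝓤) (y : Fin T → Fin 2) :
    Finset (Fin N) :=
  M.g (M.rows u y) y

theorem rows_eq_X (M : AdaptiveOneBitCS N K T (𝓤 := 𝓤) μ) (ω : Ω) (t : Fin T) :
    M.rows (M.U ω) (fun s => M.Y s ω) t = M.X t ω := by
  induction t using WellFoundedLT.induction with
  | ind t ih =>
    rw [rows, M.X_eq]
    congr 1
    funext s
    exact ih s.1 s.2

theorem estimate_eq_decoder (M : AdaptiveOneBitCS N K T (𝓤 := 𝓤) μ) (ω : Ω) :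
    M.estimate (M.U ω) (fun t => M.Y t ω) = M.g (fun t => M.X t ω) (fun t => M.Y t ω) := by
  rw [estimate, funext (M.rows_eq_X ω)]

theorem measurable_rows (M : AdaptiveOneBitCS N K T (𝓤 := 𝓤) μ) (y : Fin T → Fin 2)
    (t : Fin T) : Measurable fun u => M.rows u y t := by
  induction t using WellFoundedLT.induction with
  | ind t ih =>
    have h : Measurable fun u => ((fun s : Set.Iio t => M.rows u y s.1),
        (fun s : Set.Iio t => y s.1), u) :=
      (measurable_pi_lambda _ fun s : Set.Iio t => ih s.1 s.2).prodMk
        (measurable_const.prodMk measurable_id)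
    have h' := (M.measurable_f t).comp h
    convert h' using 2 with u
    rw [rows, Function.comp_apply]

theorem measurableSet_estimate_eq (M : AdaptiveOneBitCS N K T (𝓤 := 𝓤) μ) (y : Fin T → Fin 2)
    (S : Finset (Fin N)) : MeasurableSet {u | M.estimate u y = S} :=
  ((measurable_pi_lambda _ (M.measurable_rows y)).prodMk measurable_const) (M.measurable_g S)

theorem measurableSet_support_eq (M : AdaptiveOneBitCS N K T (𝓤 := 𝓤) μ) (S : Finset (Fin N)) :
    MeasurableSet {ω | vectorSupport (M.β ω) = S} :=
  M.measurable_β (measurableSet_vectorSupport_eq S)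

/-- Sets of size other than `K` are null: those of size `K` already have total mass `1`. -/
theorem measureReal_support_eq_le [IsProbabilityMeasure μ] (M : AdaptiveOneBitCS N K T (𝓤 := 𝓤) μ)
    (hKN : K ≤ N) (S : Finset (Fin N)) :
    μ.real {ω | vectorSupport (M.β ω) = S} ≤ 1 / (N.choose K : ℝ) := by
  by_cases hS : S.card = K
  · exact (M.uniform_support S hS).le
  have hC : (0 : ℝ) < N.choose K := by exact_mod_cast Nat.choose_pos hKN
  have hsum : ∑ R ∈ insert S (Finset.univ.powersetCard K),
      μ.real {ω | vectorSupport (M.β ω) = R} ≤ 1 := by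
    rw [← measureReal_biUnion_finset]
    · exact measureReal_le_one
    · intro R _ R' _ hne
      exact Set.disjoint_left.2 fun ω h h' => hne (h.symm.trans h')
    · exact fun R _ => M.measurableSet_support_eq R
  rw [Finset.sum_insert (by simp [hS]), Finset.sum_congr rfl fun R hR =>
    M.uniform_support R (Finset.mem_powersetCard.1 hR).2] at hsum
  simp only [Finset.sum_const, Finset.card_powersetCard, Finset.card_univ, Fintype.card_fin,
    nsmul_eq_mul, mul_one_div_cancel hC.ne'] at hsum
  have : 0 ≤ 1 / (N.choose K : ℝ) := by positivity
  linarith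

/-- For a fixed output word, the estimate is a function of the internal randomness alone, hence
independent of the support, and it guesses the support with at most uniform probability. -/
theorem measureReal_estimate_eq_support_le [IsProbabilityMeasure μ]
    (M : AdaptiveOneBitCS N K T (𝓤 := 𝓤) μ) (hKN : K ≤ N) (y : Fin T → Fin 2) :
    μ.real {ω | M.estimate (M.U ω) y = vectorSupport (M.β ω)} ≤ 1 / (N.choose K : ℝ) := by
  have hindep : IndepFun M.U M.β μ :=
    M.indep_U.comp measurable_id measurable_fst
  have hsub : {ω | M.estimate (M.U ω) y = vectorSupport (M.β ω)} ⊆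
      ⋃ S ∈ (Finset.univ : Finset (Finset (Fin N))),
        {ω | M.estimate (M.U ω) y = S} ∩ {ω | vectorSupport (M.β ω) = S} := by
    intro ω hω
    simpa [eq_comm] using hω
  have htotal : ∑ S : Finset (Fin N), μ.real {ω | M.estimate (M.U ω) y = S} ≤ 1 := by
    rw [← measureReal_biUnion_finset]
    · exact measureReal_le_one
    · intro R _ R' _ hne
      exact Set.disjoint_left.2 fun ω h h' => hne (h.symm.trans h')
    · exact fun S _ => M.measurable_U (M.measurableSet_estimate_eq y S)
  calc μ.real {ω | M.estimate (M.U ω) y = vectorSupport (M.β ω)}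
      ≤ ∑ S : Finset (Fin N),
          μ.real ({ω | M.estimate (M.U ω) y = S} ∩ {ω | vectorSupport (M.β ω) = S}) :=
        (measureReal_mono hsub (measure_ne_top μ _)).trans (measureReal_biUnion_finset_le _ _)
    _ = ∑ S : Finset (Fin N), μ.real {ω | M.estimate (M.U ω) y = S} *
          μ.real {ω | vectorSupport (M.β ω) = S} := by
        refine Finset.sum_congr rfl fun S _ => ?_
        have h := hindep.measure_inter_preimage_eq_mul _ _ (M.measurableSet_estimate_eq y S)
          (measurableSet_vectorSupport_eq S)
        simpa [measureReal_def, ENNReal.toReal_mul] using congrArg ENNReal.toReal h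
    _ ≤ ∑ S : Finset (Fin N), μ.real {ω | M.estimate (M.U ω) y = S} * (1 / (N.choose K : ℝ)) := by
        gcongr with S
        exact M.measureReal_support_eq_le hKN S
    _ ≤ 1 / (N.choose K : ℝ) := by
        rw [← Finset.sum_mul]
        exact mul_le_of_le_one_left (by positivity) htotal

theorem one_sub_errorProb_le [IsProbabilityMeasure μ] (M : AdaptiveOneBitCS N K T (𝓤 := 𝓤) μ)
    (hKN : K ≤ N) : 1 - M.errorProb ≤ 2 ^ T / (N.choose K : ℝ) := by
  have hcover : (Set.univ : Set Ω) ⊆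
      {ω | M.g (fun t => M.X t ω) (fun t => M.Y t ω) ≠ vectorSupport (M.β ω)} ∪
        ⋃ y ∈ (Finset.univ : Finset (Fin T → Fin 2)),
          {ω | M.estimate (M.U ω) y = vectorSupport (M.β ω)} := by
    intro ω _
    by_cases h : M.g (fun t => M.X t ω) (fun t => M.Y t ω) = vectorSupport (M.β ω)
    · right
      simp only [Finset.mem_univ, Set.iUnion_true, Set.mem_iUnion, Set.mem_ofPred_eq]
      exact ⟨fun t => M.Y t ω, (M.estimate_eq_decoder ω).trans h⟩
    · exact Or.inl h
  have hone : 1 ≤ M.errorProb + ∑ y : Fin T → Fin 2,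
      μ.real {ω | M.estimate (M.U ω) y = vectorSupport (M.β ω)} := by
    calc (1 : ℝ) = μ.real Set.univ := probReal_univ.symm
      _ ≤ _ := (measureReal_mono hcover).trans ((measureReal_union_le _ _).trans
          (add_le_add le_rfl (measureReal_biUnion_finset_le _ _)))
  have hlist : ∑ y : Fin T → Fin 2,
      μ.real {ω | M.estimate (M.U ω) y = vectorSupport (M.β ω)} ≤ 2 ^ T / (N.choose K : ℝ) := by
    refine (Finset.sum_le_sum fun y _ => M.measureReal_estimate_eq_support_le hKN y).trans_eq ?_
    simp [div_eq_mul_inv]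
  linarith

theorem half_mul_log_le [IsProbabilityMeasure μ] (M : AdaptiveOneBitCS N K T (𝓤 := 𝓤) μ)
    (hK : 1 ≤ K) (hKN : K ≤ N) (herr : M.errorProb ≤ 1 / 4) :
    1 / 2 * ((K : ℝ) * Real.log ((N : ℝ) / (K : ℝ))) ≤ (T : ℝ) := by
  have hC : (0 : ℝ) < N.choose K := by exact_mod_cast Nat.choose_pos hKN
  have hbound : 3 * (N.choose K : ℝ) ≤ 4 * 2 ^ T := by
    have h := M.one_sub_errorProb_le hKN
    rw [le_div_iff₀ hC] at h
    nlinarith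
  have hchoose : (N.choose K : ℝ) ≤ 4 ^ T := by
    have hnat : 3 * N.choose K ≤ 4 * 2 ^ T := by exact_mod_cast hbound
    rcases Nat.eq_zero_or_pos T with rfl | hT
    -- Without measurements, integrality of the binomial coefficient is what forces it to be `1`.
    · have : N.choose K ≤ 1 := by omega
      simpa using this
    · have h2 : 2 ≤ 2 ^ T := Nat.le_self_pow hT.ne' 2
      have h4 : (4 : ℕ) ^ T = 2 ^ T * 2 ^ T := by
        rw [← mul_pow]
        norm_num
      have : N.choose K ≤ 4 ^ T := by nlinarith
      exact_mod_cast this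
  have hKpos : (0 : ℝ) < K := by exact_mod_cast hK
  have hNpos : (0 : ℝ) < N := by exact_mod_cast hK.trans hKN
  have hlog := Real.log_le_log (by positivity) ((div_pow_le_choose hKN).trans hchoose)
  rw [Real.log_pow, Real.log_pow] at hlog
  have hlog4 : Real.log 4 ≤ 2 := by
    rw [show (4 : ℝ) = 2 ^ 2 by norm_num, Real.log_pow]
    have := Real.log_two_lt_d9
    push_cast
    linarith
  have hT : (0 : ℝ) ≤ T := T.cast_nonneg
  nlinarith

end AdaptiveOneBitCS

theorem theorem4 :
    -- absolute constants: an error probability of at most `ε₀` forces `T ≥ c K log (N / K)`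
    (∃ c : ℝ, 0 < c ∧ ∃ ε₀ : ℝ, 0 < ε₀ ∧
      ∀ (N K T : ℕ), 1 ≤ K → K ≤ N →
      ∀ (Ω : Type*) (𝓤 : Type*) [MeasurableSpace Ω] [MeasurableSpace 𝓤]
        (μ : Measure Ω) [IsProbabilityMeasure μ] (M : AdaptiveOneBitCS N K T (𝓤 := 𝓤) μ),
        M.errorProb ≤ ε₀ → c * ((K : ℝ) * Real.log ((N : ℝ) / (K : ℝ))) ≤ (T : ℝ)) ∧
    -- along any sequence of problems with vanishing error, `T = Ω(K log (N / K))`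
    (∀ (N K T : ℕ → ℕ), (∀ n, 1 ≤ K n) → (∀ n, K n ≤ N n) →
      ∀ (Ω : ℕ → Type*) (𝓤 : ℕ → Type*) [∀ n, MeasurableSpace (Ω n)]
        [∀ n, MeasurableSpace (𝓤 n)] (μ : ∀ n, Measure (Ω n)) [∀ n, IsProbabilityMeasure (μ n)]
        (M : ∀ n, AdaptiveOneBitCS (N n) (K n) (T n) (𝓤 := 𝓤 n) (μ n)),
        Tendsto (fun n => (M n).errorProb) atTop (𝓝 0) →
        (fun n => (K n : ℝ) * Real.log ((N n : ℝ) / (K n : ℝ))) =O[atTop]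
          (fun n => (T n : ℝ))) := by
  refine ⟨⟨1 / 2, by norm_num, 1 / 4, by norm_num, ?_⟩, ?_⟩
  · intro N K T hK hKN Ω 𝓤 _ _ μ _ M herr
    exact M.half_mul_log_le hK hKN herr
  · intro N K T hK hKN Ω 𝓤 _ _ μ _ M herr
    refine IsBigO.of_bound 2 ?_
    filter_upwards [herr.eventually_le_const (by norm_num : (0 : ℝ) < 1 / 4)] with n hn
    have hbound := (M n).half_mul_log_le (hK n) (hKN n) hn
    have hKpos : (0 : ℝ) < K n := by exact_mod_cast hK n
    have hnonneg : 0 ≤ (K n : ℝ) * Real.log ((N n : ℝ) / (K n : ℝ)) := by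
      refine mul_nonneg hKpos.le (Real.log_nonneg ?_)
      rw [one_le_div hKpos]
      exact_mod_cast hKN n
    rw [Real.norm_of_nonneg hnonneg, Real.norm_of_nonneg (Nat.cast_nonneg _)]
    linarith
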